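/- Write $\Sigma=\{0,1\}$, let $\mu$ be the uniform (Lebesgue, fair-coin) probability measure on $\{0,1\}^{\mathbb N}$, and for a language $L\subseteq\Sigma^*$ let $[L]$ be the set of all infinite sequences having some word of $L$ as a prefix. An *automatic family* is a family of languages $\mathcal U=(U_i)_{i\in I}$, $U_i\subseteq\Sigma^*$, whose index set $I\subseteq\Sigma^*$ is a regular language and for which $\{(x,i)\mid i\in I,\ x\in U_i\}$ is an automatic relation, i.e. there is a finite automaton which, reading the two words $x,i$ synchronously letter by letter (the shorter one padded at its end by a new symbol $\#$), accepts exactly the pairs in the relation. It is an *automatic randomness test* (ART) if $\liminf_{i\in I}\mu[U_i]=0$, the limit inferior being taken along the infinite set $I$ as $|i|\to\infty$ (so an ART has infinite index set). Its *covering region* is $F(\mathcal U)=\bigcap_{i\in I}[U_i]$. A deterministic Büchi or Muller automaton consists of a finite state set $S$, a transition function $S\times\Sigma\to S$, a starting state from which all states are reachable, and a set $A\subseteq S$ (Büchi), respectively a collection $A\subseteq\mathcal P(S)$ (Muller). Let $\mathrm{Inf}(X)$ be the set of states that occur infinitely often in the run on the infinite sequence $X$. A Büchi automaton accepts $X$ if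 $\mathrm{Inf}(X)\cap A\neq\emptyset$, and a Muller automaton accepts $X$ if $\mathrm{Inf}(X)\in A$. The automaton has *measure zero* if the set of all sequences it accepts has $\mu$-measure $0$. A sequence is *disjunctive* if every word of $\Sigma^*$ appears in it as a block of consecutive letters. **Theorem 8 (Characterization).** For an infinite sequence $X\in\{0,1\}^{\mathbb N}$ the following are equivalent: 1. $X\in F(\mathcal U)$ for some ART $\mathcal U$; 2. $X$ is accepted by some deterministic Büchi automaton of measure zero; 3. $X$ is accepted by some deterministic Muller automaton of measure zero; 4. $X$ is not disjunctive. -/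

import Mathlib

open MeasureTheory

namespace AutomaticRandomness

/-! ### Words, sequences, and the Cantor space

Words over `{0,1}` are `List Bool`, infinite sequences are `ℕ → Bool` (indexed from `0`). -/

/-- The word `w` is a prefix of the infinite sequence `X`. -/
def IsPrefixOf (w : List Bool) (X : ℕ → Bool) : Prop :=
  ∀ j (h : j < w.length), X j = w[j]

/-- The class `[L]` of all infinite sequences which extend some word of the language `L`. -/
def extensions (L : Language Bool) : Set (ℕ → Bool) :=
  {X | ∃ w ∈ L, IsPrefixOf w X}

/-- The uniform (Lebesgue) measure on the Cantor space: the infinite product of the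
equiprobable measure on `{0,1}`. -/
noncomputable def cantorMeasure : Measure (ℕ → Bool) :=
  Measure.infinitePi fun _ : ℕ => (PMF.uniformOfFintype Bool).toMeasure

/-- `X` is disjunctive if every finite word appears in `X` as a subword
(a block of consecutive letters). -/
def Disjunctive (X : ℕ → Bool) : Prop :=
  ∀ w : List Bool, ∃ k : ℕ, ∀ j (h : j < w.length), X (k + j) = w[j]

/-! ### Automatic relations, automatic families, automatic randomness tests -/

/-- The convolution of two words: they are written one above the other, and the shorter one is
padded at its end by the symbol `#`, represented by `none`. -/
def convolution (x y : List Bool) : List (Option Bool × Option Bool) :=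
  (List.range (max x.length y.length)).map fun n => (x[n]?, y[n]?)

/-- A binary relation on words is automatic if some finite automaton, reading the convolution
of a pair of words, accepts it exactly when the pair is in the relation. -/
def IsAutomatic (R : List Bool → List Bool → Prop) : Prop :=
  ∃ (S : Type) (_ : Finite S) (M : DFA (Option Bool × Option Bool) S),
    ∀ x y, convolution x y ∈ M.accepts ↔ R x y

/-- An automatic family `(U_i)_{i ∈ I}` of languages: the index set `I` is a regular language and
`{(x, i) | i ∈ I, x ∈ U_i}` is an automatic relation. -/
structure AutomaticFamily where
  index : Language Bool
  regular_index : index.IsRegular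
  member : {i : List Bool // i ∈ index} → Language Bool
  automatic : IsAutomatic fun x i => ∃ h : i ∈ index, x ∈ member ⟨i, h⟩

namespace AutomaticFamily

/-- An automatic family is an automatic randomness test if `liminf_{i ∈ I} μ[U_i] = 0`
(the limit inferior is that of any enumeration of `I` without repetitions,
and is `∞` when `I` is finite). -/
def IsART (U : AutomaticFamily) : Prop :=
  Filter.liminf (fun i => cantorMeasure (extensions (U.member i))) Filter.cofinite = 0

/-- The covering region `F(U) = ⋂_{i ∈ I} [U_i]`. -/
def coveringRegion (U : AutomaticFamily) : Set (ℕ → Bool) :=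
  ⋂ i, extensions (U.member i)

end AutomaticFamily

/-! ### Automata on infinite sequences -/

/-- A finite state machine over the alphabet `{0,1}` with state set `S`, all of whose states are
reachable from the starting state. -/
structure FSM (S : Type) [Finite S] where
  step : S → Bool → S
  start : S
  reachable : ∀ s : S, ∃ w : List Bool, w.foldl step start = s

namespace FSM

variable {S : Type} [Finite S]

/-- The infinite run of states induced by a sequence. -/
def run (M : FSM S) (X : ℕ → Bool) : ℕ → S
  | 0 => M.start
  | n + 1 => M.step (M.run X n) (X n)

/-- The set `I(X)` of states which occur infinitely often in the run of `X`. -/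
def infStates (M : FSM S) (X : ℕ → Bool) : Set S :=
  {s | {n | M.run X n = s}.Infinite}

end FSM

/-- A deterministic Büchi automaton. -/
structure BuchiAutomaton (S : Type) [Finite S] extends FSM S where
  accept : Set S

/-- The class of all sequences whose run visits some accepting state infinitely often. -/
def BuchiAutomaton.language {S : Type} [Finite S] (M : BuchiAutomaton S) : Set (ℕ → Bool) :=
  {X | ∃ s ∈ M.infStates X, s ∈ M.accept}

/-- A deterministic Muller automaton. -/
structure MullerAutomaton (S : Type) [Finite S] extends FSM S where
  accept : Set (Set S)

/-- The class of all sequences `X` such that the set of states visited infinitely often in the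
run of `X` belongs to the accepting collection. -/
def MullerAutomaton.language {S : Type} [Finite S] (M : MullerAutomaton S) : Set (ℕ → Bool) :=
  {X | M.infStates X ∈ M.accept}

end AutomaticRandomness

namespace AutomaticRandomness

/-! The proof runs through the cycle 1 → 2 → 3 → 4 → 1. From a test to an automaton: call `y`
excluded if some index `i` of the same length has no member of `U_i` comparable with `y`. No
sequence in the covering region has an excluded prefix. The excluded words form a regular language
(`isRegular_excluded`), so avoiding them is a Büchi condition (`ExtensionClosed.exists_buchi`). If
`i` does not exclude `y`, finiteness of the automaton yields a word of `U_i` at most `c` letters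
beyond `y`, with `c` independent of `i` and `y`. Hence `2⁻¹ ^ c` times the measure of the avoiding
class is at most every `μ[U_i]`, and the class is null. A Büchi condition is a Muller condition. On
a disjunctive sequence every state that stays reachable recurs, so the recurrent states form a trap,
with the same recurrent set for all disjunctive sequences entering it. As almost all sequences are
disjunctive, a Muller automaton accepting one of them accepts almost all of a cylinder
(`MullerAutomaton.measure_language_pos`). Finally, a sequence omitting `w` is covered by the test
whose members are the words of length `|i|` omitting `w`. -/

/-! ### Initial segments and cylinders -/

/-- The initial segment of length `n` of the sequence `X`. -/
def initSeg (X : ℕ → Bool) (n : ℕ) : List Bool := (List.range n).map X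

@[simp] lemma length_initSeg (X : ℕ → Bool) (n : ℕ) : (initSeg X n).length = n := by
  simp [initSeg]

@[simp] lemma initSeg_zero (X : ℕ → Bool) : initSeg X 0 = [] := rfl

lemma initSeg_succ (X : ℕ → Bool) (n : ℕ) : initSeg X (n + 1) = initSeg X n ++ [X n] := by
  simp [initSeg, List.range_succ]

lemma initSeg_add (X : ℕ → Bool) (n k : ℕ) :
    initSeg X (n + k) = initSeg X n ++ initSeg (fun j => X (n + j)) k := by
  simp [initSeg, List.range_add]

lemma initSeg_prefix_of_le (X : ℕ → Bool) {n m : ℕ} (h : n ≤ m) :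
    initSeg X n <+: initSeg X m := by
  obtain ⟨k, rfl⟩ := Nat.exists_eq_add_of_le h
  rw [initSeg_add]
  exact List.prefix_append _ _

lemma initSeg_eq_iff {X : ℕ → Bool} {w : List Bool} :
    initSeg X w.length = w ↔ ∀ j (h : j < w.length), X j = w[j] := by
  constructor
  · intro h j hj
    have : (initSeg X w.length)[j]'(by simpa using hj) = w[j] := by
      simp only [h]
    simpa [initSeg] using this
  · intro h
    apply List.ext_getElem (by simp)
    intro j h₁ h₂
    simpa [initSeg] using h j h₂

lemma isPrefixOf_iff {X : ℕ → Bool} {w : List Bool} :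
    IsPrefixOf w X ↔ initSeg X w.length = w := initSeg_eq_iff.symm

lemma isPrefixOf_initSeg (X : ℕ → Bool) (n : ℕ) : IsPrefixOf (initSeg X n) X := by
  simp [isPrefixOf_iff]

lemma IsPrefixOf.of_prefix {X : ℕ → Bool} {u w : List Bool} (h : u <+: w)
    (hw : IsPrefixOf w X) : IsPrefixOf u X := fun j hj => by
  rw [hw j (hj.trans_le h.length_le), h.getElem hj]

lemma mem_extensions_iff {L : Language Bool} {X : ℕ → Bool} :
    X ∈ extensions L ↔ ∃ n, initSeg X n ∈ L := by
  constructor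
  · rintro ⟨w, hw, h⟩
    exact ⟨w.length, by rwa [isPrefixOf_iff.1 h]⟩
  · rintro ⟨n, hn⟩
    exact ⟨_, hn, isPrefixOf_initSeg X n⟩

/-- The class of all infinite sequences with prefix `w`. -/
def cyl (w : List Bool) : Set (ℕ → Bool) := {X | IsPrefixOf w X}

lemma cyl_eq_pi (w : List Bool) :
    cyl w = Set.pi (Finset.range w.length) fun j => {w.getD j false} := by
  ext X
  simp only [cyl, IsPrefixOf, Set.mem_ofPred_eq, Set.mem_pi, Finset.coe_range, Set.mem_Iio,
    Set.mem_singleton_iff]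
  exact forall₂_congr fun j hj => by simp [hj]

lemma measurableSet_cyl (w : List Bool) : MeasurableSet (cyl w) := by
  rw [cyl_eq_pi]
  exact MeasurableSet.pi (Finset.countable_toSet _) fun _ _ => measurableSet_singleton _

lemma extensions_eq_biUnion (L : Language Bool) : extensions L = ⋃ w ∈ {w | w ∈ L}, cyl w := by
  ext X
  simp [extensions, cyl]

lemma measurableSet_extensions (L : Language Bool) : MeasurableSet (extensions L) := by
  rw [extensions_eq_biUnion]
  exact MeasurableSet.biUnion (Set.to_countable _) fun w _ => measurableSet_cyl w

instance : IsProbabilityMeasure cantorMeasure := by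
  unfold cantorMeasure
  infer_instance

lemma cantorMeasure_cyl (w : List Bool) : cantorMeasure (cyl w) = (2 : ENNReal)⁻¹ ^ w.length := by
  rw [cyl_eq_pi, cantorMeasure, Measure.infinitePi_pi _ fun _ _ => measurableSet_singleton _]
  simp

lemma cyl_subset_of_prefix {u w : List Bool} (h : u <+: w) : cyl w ⊆ cyl u :=
  fun _ hX => IsPrefixOf.of_prefix h hX

lemma setOf_initSeg_mem_eq (n : ℕ) (P : Set (List Bool)) :
    {X | initSeg X n ∈ P} = ⋃ y ∈ {y | y.length = n ∧ y ∈ P}, cyl y := by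
  ext X
  simp only [Set.mem_ofPred_eq, Set.mem_iUnion, cyl, exists_prop]
  constructor
  · exact fun h => ⟨_, ⟨by simp, h⟩, isPrefixOf_initSeg X n⟩
  · rintro ⟨y, ⟨rfl, hy⟩, h⟩
    rwa [isPrefixOf_iff.1 h]

lemma measurableSet_setOf_initSeg_mem (n : ℕ) (P : Set (List Bool)) :
    MeasurableSet {X | initSeg X n ∈ P} := by
  rw [setOf_initSeg_mem_eq]
  exact MeasurableSet.biUnion (Set.to_countable _) fun w _ => measurableSet_cyl w

/-- If `V` has relative measure at least `δ` in each of the cylinders given by words of length `n`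
in `P`, then it has relative measure at least `δ` in their union. -/
lemma mul_measure_initSeg_mem_le (n : ℕ) (P : Set (List Bool)) {V : Set (ℕ → Bool)} {δ : ENNReal}
    (hV : MeasurableSet V)
    (h : ∀ y ∈ P, y.length = n → δ * cantorMeasure (cyl y) ≤ cantorMeasure (V ∩ cyl y)) :
    δ * cantorMeasure {X | initSeg X n ∈ P} ≤ cantorMeasure (V ∩ {X | initSeg X n ∈ P}) := by
  have hd : {y : List Bool | y.length = n ∧ y ∈ P}.PairwiseDisjoint cyl := by
    intro y hy z hz hyz
    refine Set.disjoint_left.2 fun X hX hX' => hyz ?_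
    rw [← isPrefixOf_iff.1 hX, ← isPrefixOf_iff.1 hX', hy.1, hz.1]
  have hc : {y : List Bool | y.length = n ∧ y ∈ P}.Countable := Set.to_countable _
  rw [setOf_initSeg_mem_eq, Set.inter_iUnion₂,
    measure_biUnion hc hd fun _ _ => measurableSet_cyl _,
    measure_biUnion hc (fun y hy z hz hyz => (hd hy hz hyz).mono Set.inter_subset_right
      Set.inter_subset_right) fun _ _ => hV.inter (measurableSet_cyl _),
    ← ENNReal.tsum_mul_left]
  exact ENNReal.tsum_le_tsum fun y => h y y.2.2 y.2.1

/-! ### Languages closed under extension -/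

/-- The language contains all extensions of its words. -/
def ExtensionClosed (L : Language Bool) : Prop := ∀ y ∈ L, ∀ z, y ++ z ∈ L

lemma ExtensionClosed.mem_of_prefix {L : Language Bool} (hL : ExtensionClosed L) {y z : List Bool}
    (hy : y ∈ L) (h : y <+: z) : z ∈ L := by
  obtain ⟨t, rfl⟩ := h
  exact hL y hy t

lemma compl_extensions_eq_iInter (L : Language Bool) :
    (extensions L)ᶜ = ⋂ n, {X | initSeg X n ∈ {y | y ∉ L}} := by
  ext X
  simp [mem_extensions_iff]

lemma tendsto_measure_initSeg_notMem {L : Language Bool} (hL : ExtensionClosed L) :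
    Filter.Tendsto (fun n => cantorMeasure {X | initSeg X n ∈ {y | y ∉ L}}) Filter.atTop
      (nhds (cantorMeasure (extensions L)ᶜ)) := by
  rw [compl_extensions_eq_iInter]
  refine tendsto_measure_iInter_atTop
    (fun n => (measurableSet_setOf_initSeg_mem n _).nullMeasurableSet)
    (fun n m hnm X hX hX' => hX (hL.mem_of_prefix hX' (initSeg_prefix_of_le X hnm)))
    ⟨0, measure_ne_top _ _⟩

/-- Let `m` be the measure of the complement. Each cylinder outside `L` at level `n` gives at least
the fraction `2⁻¹ ^ c` of its mass to `[L]`, so the mass outside `L` at level `n` is at least `m +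
2⁻¹ ^ c * m`. It tends to `m`, which forces `m = 0`. -/
lemma measure_compl_extensions_eq_zero {L : Language Bool} (hL : ExtensionClosed L) {c : ℕ}
    (hc : ∀ y, y ∉ L → ∃ z : List Bool, z.length ≤ c ∧ y ++ z ∈ L) :
    cantorMeasure (extensions L)ᶜ = 0 := by
  set δ : ENNReal := 2⁻¹ ^ c
  have key (n : ℕ) : cantorMeasure (extensions L)ᶜ + δ * cantorMeasure (extensions L)ᶜ ≤
      cantorMeasure {X | initSeg X n ∈ {y | y ∉ L}} := by
    have hsub : (extensions L)ᶜ ⊆ {X | initSeg X n ∈ {y | y ∉ L}} := by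
      rw [compl_extensions_eq_iInter]
      exact Set.iInter_subset _ n
    have h := mul_measure_initSeg_mem_le n {y | y ∉ L} (δ := δ) (measurableSet_extensions L) ?_
    · calc _ ≤ cantorMeasure (extensions L)ᶜ +
            cantorMeasure (extensions L ∩ {X | initSeg X n ∈ {y | y ∉ L}}) := by
            gcongr
            exact le_trans (by gcongr) h
        _ = cantorMeasure ((extensions L)ᶜ ∪
            (extensions L ∩ {X | initSeg X n ∈ {y | y ∉ L}})) :=
            (measure_union (disjoint_compl_left.mono_right Set.inter_subset_left)
              ((measurableSet_extensions L).inter (measurableSet_setOf_initSeg_mem n _))).symm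
        _ ≤ _ := measure_mono (Set.union_subset hsub Set.inter_subset_right)
    · intro y hy _
      obtain ⟨z, hz, hyz⟩ := hc y hy
      calc δ * cantorMeasure (cyl y) ≤ cantorMeasure (cyl (y ++ z)) := by
            rw [cantorMeasure_cyl, cantorMeasure_cyl, List.length_append, pow_add, mul_comm]
            exact mul_le_mul_right (pow_le_pow_right_of_le_one' (by simp) hz) _
        _ ≤ _ := measure_mono (Set.subset_inter
            (show cyl (y ++ z) ⊆ extensions L from fun X hX => ⟨_, hyz, hX⟩)
            (cyl_subset_of_prefix (List.prefix_append y z)))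
  have h := ge_of_tendsto' (tendsto_measure_initSeg_notMem hL) key
  have h0 : δ * cantorMeasure (extensions L)ᶜ = 0 := by
    refine le_antisymm ?_ zero_le
    refine (ENNReal.add_le_add_iff_left (measure_ne_top cantorMeasure (extensions L)ᶜ)).1 ?_
    simpa using h
  refine (mul_eq_zero.1 h0).resolve_left ?_
  exact pow_ne_zero _ (by simp)

/-! ### Words containing a given block -/

/-- The language of all words which contain the block `w`. -/
def containing (w : List Bool) : Language Bool := {y | w <:+: y}

lemma mem_containing {w y : List Bool} : y ∈ containing w ↔ w <:+: y := Iff.rfl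

lemma extensionClosed_containing (w : List Bool) : ExtensionClosed (containing w) :=
  fun _ hy z => hy.trans (List.prefix_append _ z).isInfix

lemma measure_compl_extensions_containing (w : List Bool) :
    cantorMeasure (extensions (containing w))ᶜ = 0 :=
  measure_compl_extensions_eq_zero (extensionClosed_containing w) (c := w.length)
    fun y _ => ⟨w, le_rfl, (List.suffix_append y w).isInfix⟩

lemma mem_extensions_containing_iff {X : ℕ → Bool} {w : List Bool} :
    X ∈ extensions (containing w) ↔ ∃ k, ∀ j (h : j < w.length), X (k + j) = w[j] := by
  simp_rw [mem_extensions_iff, mem_containing,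
    ← initSeg_eq_iff (X := fun j => X (_ + j))]
  constructor
  · rintro ⟨n, s, t, h⟩
    have hn : n = s.length + w.length + t.length := by
      simpa [add_assoc] using (congrArg List.length h).symm
    subst hn
    rw [initSeg_add, initSeg_add] at h
    have h₁ := List.append_inj_left h (by simp)
    exact ⟨s.length, (List.append_inj_right h₁ (by simp)).symm⟩
  · rintro ⟨k, h⟩
    refine ⟨k + w.length, ?_⟩
    rw [initSeg_add, h]
    exact (List.suffix_append _ w).isInfix

lemma disjunctive_iff {X : ℕ → Bool} :
    Disjunctive X ↔ ∀ w, X ∈ extensions (containing w) := by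
  simp only [mem_extensions_containing_iff, Disjunctive]

lemma ae_disjunctive : ∀ᵐ X ∂cantorMeasure, Disjunctive X := by
  simp_rw [disjunctive_iff, ae_all_iff]
  exact fun w => measure_compl_extensions_containing w

/-- Every word occurs in a disjunctive sequence at arbitrarily large positions. -/
lemma Disjunctive.exists_ge {X : ℕ → Bool} (hX : Disjunctive X) (w : List Bool) (N : ℕ) :
    ∃ k ≥ N, initSeg (fun j => X (k + j)) w.length = w := by
  -- The `N` padding letters push the occurrence of `w` to a position at least `N`.
  obtain ⟨k, hk⟩ := hX (List.replicate N true ++ w)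
  refine ⟨k + N, by omega, initSeg_eq_iff.2 fun j hj => ?_⟩
  have := hk (N + j) (by simpa using hj)
  simpa [add_assoc] using this

/-! ### Runs of finite state machines on disjunctive sequences -/

namespace FSM

variable {S : Type} [Finite S] (M : FSM S)

/-- The state `t` can be reached from `s` by reading some word. -/
def Reaches (s t : S) : Prop := ∃ w : List Bool, w.foldl M.step s = t

lemma run_add (X : ℕ → Bool) (n k : ℕ) :
    M.run X (n + k) = (initSeg (fun j => X (n + j)) k).foldl M.step (M.run X n) := by
  induction k with
  | zero => rfl
  | succ k ih => rw [← add_assoc, run, ih, initSeg_succ, List.foldl_append]; rfl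

lemma run_eq_foldl (X : ℕ → Bool) (n : ℕ) :
    M.run X n = (initSeg X n).foldl M.step M.start := by
  simpa [run] using M.run_add X 0 n

variable {M} in
lemma Reaches.trans {s t u : S} (h : M.Reaches s t) (h' : M.Reaches t u) : M.Reaches s u := by
  obtain ⟨v, rfl⟩ := h
  obtain ⟨w, rfl⟩ := h'
  exact ⟨v ++ w, by rw [List.foldl_append]⟩

lemma reaches_run (X : ℕ → Bool) {n m : ℕ} (h : n ≤ m) : M.Reaches (M.run X n) (M.run X m) := by
  obtain ⟨k, rfl⟩ := Nat.exists_eq_add_of_le h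
  exact ⟨_, (M.run_add X n k).symm⟩

lemma mem_infStates_iff {X : ℕ → Bool} {s : S} :
    s ∈ M.infStates X ↔ ∀ N, ∃ n ≥ N, M.run X n = s := by
  change {n | M.run X n = s}.Infinite ↔ _
  rw [← Nat.frequently_atTop_iff_infinite, Filter.frequently_atTop]

lemma infStates_nonempty (X : ℕ → Bool) : (M.infStates X).Nonempty := by
  obtain ⟨s, hs⟩ := Finite.exists_infinite_fiber (M.run X)
  exact ⟨s, Set.infinite_coe_iff.1 hs⟩

/-- There is one word which, when read from any of the given states, visits the state `t`,
unless it leads to a state from which `t` cannot be reached. -/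
lemma exists_synchronizing_word (t : S) (qs : List S) : ∃ W : List Bool, ∀ q ∈ qs,
    (∀ u, u <+: W → M.Reaches (u.foldl M.step q) t) →
      ∃ u, u <+: W ∧ u.foldl M.step q = t := by
  induction qs with
  | nil => exact ⟨[], by simp⟩
  | cons q qs ih =>
    obtain ⟨W, hW⟩ := ih
    -- If `t` is still reachable after `W`, a path to it is appended; otherwise the premise for `q`
    -- already fails at `W`.
    by_cases hq : M.Reaches (W.foldl M.step q) t
    · obtain ⟨v, hv⟩ := hq
      refine ⟨W ++ v, fun p hp h => ?_⟩
      rcases List.mem_cons.1 hp with rfl | hp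
      · exact ⟨W ++ v, List.prefix_rfl, by rw [List.foldl_append, hv]⟩
      · obtain ⟨u, hu, h'⟩ := hW p hp fun u hu => h u (hu.trans (List.prefix_append _ _))
        exact ⟨u, hu.trans (List.prefix_append _ _), h'⟩
    · refine ⟨W, fun p hp h => ?_⟩
      rcases List.mem_cons.1 hp with rfl | hp
      · exact absurd (h W List.prefix_rfl) hq
      · exact hW p hp h

/-- On a disjunctive sequence, a state which remains reachable is visited infinitely often. -/
lemma mem_infStates_of_reaches {X : ℕ → Bool} (hX : Disjunctive X) {t : S} {N : ℕ}
    (h : ∀ m ≥ N, M.Reaches (M.run X m) t) : t ∈ M.infStates X := by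
  have := Fintype.ofFinite S
  -- The word serves all states at once, as the state in which the run meets `W` is not known
  -- beforehand.
  obtain ⟨W, hW⟩ := M.exists_synchronizing_word t Finset.univ.toList
  refine M.mem_infStates_iff.2 fun K => ?_
  obtain ⟨k, hk, hkW⟩ := hX.exists_ge W (max K N)
  have hrun (u) (hu : u <+: W) : M.run X (k + u.length) = u.foldl M.step (M.run X k) := by
    rw [run_add]
    congr 1
    refine initSeg_eq_iff.2 fun j hj => ?_
    rw [initSeg_eq_iff.1 hkW j (hj.trans_le hu.length_le), hu.getElem hj]
  obtain ⟨u, hu, hut⟩ := hW (M.run X k) (by simp) fun u hu => by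
    rw [← hrun u hu]
    exact h _ (by omega)
  exact ⟨k + u.length, by omega, by rw [hrun u hu, hut]⟩

/-- Two disjunctive sequences have the same infinitely visited states as soon as the run of the
second meets such a state of the first. -/
lemma infStates_eq_of_run_mem {X Y : ℕ → Bool} (hX : Disjunctive X) (hY : Disjunctive Y) {n : ℕ}
    (h : M.run Y n ∈ M.infStates X) : M.infStates Y = M.infStates X := by
  -- The recurrent states form a trap: since `s` recurs, `t` stays reachable from every point of the
  -- run.
  have closed {s t : S} (hs : s ∈ M.infStates X) (hst : M.Reaches s t) : t ∈ M.infStates X := by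
    refine M.mem_infStates_of_reaches hX (N := 0) fun m _ => ?_
    obtain ⟨k, hk, rfl⟩ := M.mem_infStates_iff.1 hs m
    exact (M.reaches_run X hk).trans hst
  have hY' {m : ℕ} (hm : n ≤ m) : M.run Y m ∈ M.infStates X := closed h (M.reaches_run Y hm)
  ext t
  constructor
  · intro ht
    obtain ⟨m, hm, rfl⟩ := M.mem_infStates_iff.1 ht n
    exact hY' hm
  · intro ht
    refine M.mem_infStates_of_reaches hY (N := n) fun m hm => ?_
    obtain ⟨k, -, hk⟩ := M.mem_infStates_iff.1 (hY' hm) 0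
    obtain ⟨l, hl, rfl⟩ := M.mem_infStates_iff.1 ht k
    rw [← hk]
    exact M.reaches_run X hl

end FSM

lemma MullerAutomaton.measure_language_pos {S : Type} [Finite S] (M : MullerAutomaton S)
    {X : ℕ → Bool} (hX : Disjunctive X) (h : X ∈ M.language) : 0 < cantorMeasure M.language := by
  obtain ⟨s, hs⟩ := M.infStates_nonempty X
  obtain ⟨n, -, rfl⟩ := M.mem_infStates_iff.1 hs 0
  have hsub : cyl (initSeg X n) ∩ {Y | Disjunctive Y} ⊆ M.language := by
    rintro Y ⟨hY, hYd⟩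
    have hrun : M.run Y n = M.run X n := by
      rw [M.run_eq_foldl, M.run_eq_foldl, ← isPrefixOf_iff.1 hY, length_initSeg]
    have := M.infStates_eq_of_run_mem hX hYd (n := n) (by rwa [hrun])
    change M.infStates Y ∈ M.accept
    rwa [this]
  have hle : cantorMeasure (cyl (initSeg X n)) ≤ cantorMeasure M.language := by
    refine measure_mono_ae ?_
    filter_upwards [ae_disjunctive] with Y hYd hY using hsub ⟨hY, hYd⟩
  refine lt_of_lt_of_le ?_ hle
  rw [cantorMeasure_cyl]
  exact pos_of_ne_zero (pow_ne_zero _ (by simp))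

/-- Every deterministic Büchi automaton can be seen as a Muller automaton. -/
def BuchiAutomaton.toMuller {S : Type} [Finite S] (M : BuchiAutomaton S) : MullerAutomaton S where
  toFSM := M.toFSM
  accept := {T | ∃ s ∈ T, s ∈ M.accept}

lemma BuchiAutomaton.language_toMuller {S : Type} [Finite S] (M : BuchiAutomaton S) :
    M.toMuller.language = M.language := rfl

/-! ### Regular languages -/

/-- Once a prefix lies in `L`, all later ones do, so infinitely many prefixes outside `L` means all
of them. The accepting states are therefore the rejecting states of the DFA. -/
lemma ExtensionClosed.exists_buchi {L : Language Bool} (hL : ExtensionClosed L)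
    (hreg : L.IsRegular) : ∃ (S : Type) (_ : Finite S) (M : BuchiAutomaton S),
      M.language = (extensions L)ᶜ := by
  obtain ⟨σ, _, N, rfl⟩ := hreg
  let R : Type := {s : σ // ∃ w : List Bool, w.foldl N.step N.start = s}
  let M : BuchiAutomaton R :=
    { step := fun s a => ⟨N.step s.1 a, by
        obtain ⟨w, hw⟩ := s.2
        exact ⟨w ++ [a], by rw [List.foldl_append, hw]; rfl⟩⟩
      start := ⟨N.start, [], rfl⟩
      reachable := by
        rintro ⟨s, w, rfl⟩
        refine ⟨w, ?_⟩
        induction w using List.reverseRecOn with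
        | nil => rfl
        | append_singleton w a ih => simp [List.foldl_append, ih]
      accept := {s | s.1 ∉ N.accept} }
  have hrun (X : ℕ → Bool) (n : ℕ) : (M.run X n).1 = N.eval (initSeg X n) := by
    induction n with
    | zero => rfl
    | succ n ih =>
      rw [initSeg_succ, DFA.eval_append_singleton, ← ih]
      rfl
  refine ⟨R, inferInstance, M, ?_⟩
  ext X
  rw [Set.mem_compl_iff, mem_extensions_iff]
  push Not
  constructor
  · rintro ⟨s, hs, hsa⟩ n hn
    obtain ⟨m, hm, rfl⟩ := M.mem_infStates_iff.1 hs n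
    refine hsa ?_
    rw [hrun]
    exact hL.mem_of_prefix hn (initSeg_prefix_of_le X hm)
  · intro h
    obtain ⟨s, hs⟩ := M.infStates_nonempty X
    refine ⟨s, hs, ?_⟩
    obtain ⟨n, -, rfl⟩ := M.mem_infStates_iff.1 hs 0
    change (M.run X n).1 ∉ N.accept
    rw [hrun]
    exact h n

/-- The language of all words with a prefix in `L`. -/
def extensionClosure (L : Language Bool) : Language Bool := {y | ∃ u ∈ L, u <+: y}

lemma mem_extensionClosure {L : Language Bool} {y : List Bool} :
    y ∈ extensionClosure L ↔ ∃ u ∈ L, u <+: y := Iff.rfl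

lemma extensionClosed_extensionClosure (L : Language Bool) :
    ExtensionClosed (extensionClosure L) :=
  fun _ ⟨u, hu, h⟩ z => ⟨u, hu, h.trans (List.prefix_append _ z)⟩

lemma extensions_extensionClosure (L : Language Bool) :
    extensions (extensionClosure L) = extensions L := by
  ext X
  constructor
  · rintro ⟨w, ⟨u, hu, h⟩, hw⟩
    exact ⟨u, hu, hw.of_prefix h⟩
  · rintro ⟨w, hw, h⟩
    exact ⟨w, ⟨w, hw, List.prefix_rfl⟩, h⟩

/-- The quotient by `y` is everything if `y` has a prefix in `L`, and otherwise the closure of the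
quotient of `L` by `y`. -/
lemma isRegular_extensionClosure {L : Language Bool} (hL : L.IsRegular) :
    (extensionClosure L).IsRegular := by
  refine .of_finite_range_leftQuotient <|
    ((hL.finite_range_leftQuotient.image extensionClosure).insert ⊤).subset ?_
  rintro _ ⟨y, rfl⟩
  by_cases hy : y ∈ extensionClosure L
  · refine .inl (Set.eq_univ_of_forall fun z => ?_)
    exact extensionClosed_extensionClosure L y hy z
  · refine .inr ⟨_, ⟨y, rfl⟩, ?_⟩
    ext z
    rw [Language.mem_leftQuotient, mem_extensionClosure, mem_extensionClosure]
    constructor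
    · rintro ⟨u, hu, h⟩
      exact ⟨y ++ u, hu, List.prefix_append_right_inj _ |>.2 h⟩
    · rintro ⟨u, hu, h⟩
      rcases List.prefix_or_prefix_of_prefix h (List.prefix_append y z) with h' | ⟨t, rfl⟩
      · exact absurd ⟨u, hu, h'⟩ hy
      · exact ⟨t, hu, List.prefix_append_right_inj _ |>.1 h⟩

/-- The quotient by `y` depends only on the last `|w|` letters of `y`. -/
lemma isRegular_setOf_suffix (w : List Bool) :
    Language.IsRegular ({y | w <:+ y} : Set (List Bool)) := by
  refine .of_finite_range_leftQuotient <|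
    ((List.finite_length_le Bool w.length).image
      (Language.leftQuotient ({y | w <:+ y} : Set (List Bool)))).subset ?_
  rintro _ ⟨y, rfl⟩
  refine ⟨y.drop (y.length - w.length), by simp; omega, ?_⟩
  ext z
  change w <:+ y.drop _ ++ z ↔ w <:+ y ++ z
  have hs : y.drop (y.length - w.length) ++ z <:+ y ++ z := by
    obtain ⟨s, hs⟩ := List.drop_suffix (y.length - w.length) y
    exact ⟨s, by rw [← List.append_assoc, hs]⟩
  refine ⟨fun h => h.trans hs, fun h => List.suffix_of_suffix_length_le h hs ?_⟩
  have := h.length_le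
  simp only [List.length_append, List.length_drop] at this ⊢
  omega

lemma isRegular_containing (w : List Bool) : (containing w).IsRegular := by
  convert isRegular_extensionClosure (isRegular_setOf_suffix w)
  ext y
  exact List.infix_iff_suffix_prefix

/-! ### Convolutions -/

lemma evalFrom_eval_mem_accept_iff {α σ : Type*} (M : DFA α σ) (x y : List α) :
    M.evalFrom (M.eval x) y ∈ M.accept ↔ x ++ y ∈ M.accepts := by
  change M.evalFrom (M.evalFrom M.start x) y ∈ M.accept ↔ M.evalFrom M.start (x ++ y) ∈ M.accept
  rw [DFA.evalFrom_of_append]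

lemma convolution_nil_left (y : List Bool) :
    convolution [] y = y.map fun b => (none, some b) := by
  apply List.ext_getElem (by simp [convolution])
  intro n h₁ h₂
  have : n < y.length := by simpa using h₂
  simp [convolution, this]

lemma convolution_cons_nil (a : Bool) (x : List Bool) :
    convolution (a :: x) [] = (some a, none) :: convolution x [] := by
  simp [convolution, List.range_succ_eq_map]

lemma convolution_cons_cons (a b : Bool) (x y : List Bool) :
    convolution (a :: x) (b :: y) = (some a, some b) :: convolution x y := by
  simp [convolution, Nat.succ_max_succ, List.range_succ_eq_map]

lemma convolution_append_append {x y : List Bool} (h : x.length = y.length) (u v : List Bool) :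
    convolution (x ++ u) (y ++ v) = convolution x y ++ convolution u v := by
  induction x generalizing y with
  | nil =>
    obtain rfl : y = [] := by simpa using h.symm
    simp [convolution]
  | cons a x ih =>
    cases y with
    | nil => simp at h
    | cons b y => simp [convolution_cons_cons, ih (by simpa using h)]

lemma convolution_append_right {x y : List Bool} (h : x.length ≤ y.length) (v : List Bool) :
    convolution x (y ++ v) = convolution x y ++ convolution [] v := by
  induction x generalizing y with
  | nil => simp [convolution_nil_left]
  | cons a x ih =>
    cases y with
    | nil => simp at h
    | cons b y => simp [convolution_cons_cons, ih (by simpa using h)]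

lemma isAutomatic_length_eq_and_notMem {L : Language Bool} (hL : L.IsRegular) :
    IsAutomatic fun x i => x.length = i.length ∧ x ∉ L := by
  obtain ⟨σ, _, N, rfl⟩ := hL
  -- The state `none` is a sink, entered at the first padding symbol, that is, when the lengths
  -- differ.
  let M : DFA (Option Bool × Option Bool) (Option σ) :=
    { step := fun s p => match s, p with
        | some s, (some a, some _) => some (N.step s a)
        | _, _ => none
      start := some N.start
      accept := some '' N.acceptᶜ }
  have hnone (l) : M.evalFrom none l = none := by
    induction l with
    | nil => rfl
    | cons p l ih => exact ih
  have key (x) : ∀ (i : List Bool) (s : σ), M.evalFrom (some s) (convolution x i) ∈ M.accept ↔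
      x.length = i.length ∧ N.evalFrom s x ∉ N.accept := by
    induction x with
    | nil =>
      rintro (_ | ⟨b, i⟩) s
      · simp [M, convolution]
      · rw [convolution_nil_left, List.map_cons, DFA.evalFrom_cons,
          show M.step (some s) (none, some b) = none from rfl, hnone]
        simp [M]
    | cons a x ih =>
      rintro (_ | ⟨b, i⟩) s
      · rw [convolution_cons_nil, DFA.evalFrom_cons,
          show M.step (some s) (some a, none) = none from rfl, hnone]
        simp [M]
      · rw [convolution_cons_cons, DFA.evalFrom_cons,
          show M.step (some s) (some a, some b) = some (N.step s a) from rfl, ih]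
        simp
  exact ⟨Option σ, inferInstance, M, fun x i => key x i N.start⟩

/-! ### Automatic randomness tests -/

/-- The automatic family whose members consist of the words outside of `L` with the same length as
the index. -/
def avoidingFamily (L : Language Bool) (hL : L.IsRegular) : AutomaticFamily where
  index := ⊤
  regular_index := ⟨Unit, inferInstance, ⟨fun _ _ => (), (), Set.univ⟩,
    Set.eq_univ_of_forall fun _ => Set.mem_univ _⟩
  member i := {x | x.length = i.1.length ∧ x ∉ L}
  automatic := by
    obtain ⟨S, hS, M, hM⟩ := isAutomatic_length_eq_and_notMem hL
    refine ⟨S, hS, M, fun x i => (hM x i).trans ?_⟩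
    exact ⟨fun h => ⟨Set.mem_univ i, h⟩, fun ⟨_, h⟩ => h⟩

lemma extensions_member_avoidingFamily (L : Language Bool) (hL : L.IsRegular)
    (i : {i // i ∈ (avoidingFamily L hL).index}) :
    extensions ((avoidingFamily L hL).member i) =
      {X | initSeg X i.1.length ∈ {y | y ∉ L}} := by
  ext X
  constructor
  · rintro ⟨w, ⟨hw, hwL⟩, h⟩
    change initSeg X i.1.length ∉ L
    rwa [← hw, isPrefixOf_iff.1 h]
  · exact fun h => ⟨_, ⟨by simp, h⟩, isPrefixOf_initSeg X _⟩

lemma coveringRegion_avoidingFamily {L : Language Bool} (hL : L.IsRegular) :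
    (extensions L)ᶜ ⊆ (avoidingFamily L hL).coveringRegion := by
  intro X hX
  refine Set.mem_iInter.2 fun i => ?_
  rw [extensions_member_avoidingFamily]
  exact fun h => hX (mem_extensions_iff.2 ⟨_, h⟩)

lemma ExtensionClosed.isART_avoidingFamily {L : Language Bool} (hext : ExtensionClosed L)
    (hL : L.IsRegular) (h0 : cantorMeasure (extensions L)ᶜ = 0) :
    (avoidingFamily L hL).IsART := by
  -- Infinitely many indices make the cofinite filter nontrivial, so that the limit is the liminf.
  have : Infinite {i // i ∈ (avoidingFamily L hL).index} :=
    Set.infinite_coe_iff.2 (Set.infinite_univ (α := List Bool))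
  have hlen : Filter.Tendsto (fun i : {i // i ∈ (avoidingFamily L hL).index} => i.1.length)
      Filter.cofinite Filter.atTop := by
    refine Filter.tendsto_atTop.2 fun b => Filter.eventually_cofinite.2 ?_
    simp only [not_le]
    exact (List.finite_length_lt Bool b).preimage Subtype.val_injective.injOn
  have := (tendsto_measure_initSeg_notMem hext).comp hlen
  rw [h0] at this
  unfold AutomaticFamily.IsART
  simp_rw [extensions_member_avoidingFamily]
  exact this.liminf_eq

/-! ### Excluded words: from a test to a regular language -/

namespace AutomaticFamily

variable (U : AutomaticFamily)

/-- The word `i` is an index, and no member of `U_i` is comparable with `y`. -/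
def Excludes (y i : List Bool) : Prop :=
  ∃ h : i ∈ U.index, ∀ x, (x <+: y ∨ y <+: x) → x ∉ U.member ⟨i, h⟩

/-- The language of all words excluded by some index of the same length. -/
def excluded : Language Bool := {y | ∃ i, y.length = i.length ∧ U.Excludes y i}

/-- A word comparable with `y ++ z` is a prefix of `y` or has the form `y ++ x` with `x` comparable
with `z`. Hence `(y, i)` matters only through finitely many possible data: the state of `J` after
`i`, the state of `M` after `(y, i)`, and the set of states of `M` after `(x, i)` for prefixes `x`
of `y`. -/
lemma excludes_append_iff {S T : Type} {M : DFA (Option Bool × Option Bool) S} {J : DFA Bool T}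
    (hM : ∀ x i, convolution x i ∈ M.accepts ↔ ∃ h : i ∈ U.index, x ∈ U.member ⟨i, h⟩)
    (hJ : J.accepts = U.index) {y i : List Bool} (h : y.length = i.length) (z k : List Bool) :
    U.Excludes (y ++ z) (i ++ k) ↔ J.evalFrom (J.eval i) k ∈ J.accept ∧
      (∀ p ∈ (fun x => M.eval (convolution x i)) '' {x | x <+: y},
        M.evalFrom p (convolution [] k) ∉ M.accept) ∧
      ∀ x, (x <+: z ∨ z <+: x) →
        M.evalFrom (M.eval (convolution y i)) (convolution x k) ∉ M.accept := by
  have hI : J.evalFrom (J.eval i) k ∈ J.accept ↔ i ++ k ∈ U.index := by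
    rw [← hJ, evalFrom_eval_mem_accept_iff]
  have h₁ (x) (hx : x <+: y) : M.evalFrom (M.eval (convolution x i)) (convolution [] k) ∈ M.accept
      ↔ ∃ h : i ++ k ∈ U.index, x ∈ U.member ⟨i ++ k, h⟩ := by
    rw [← hM, convolution_append_right (hx.length_le.trans_eq h), evalFrom_eval_mem_accept_iff]
  have h₂ (x) : M.evalFrom (M.eval (convolution y i)) (convolution x k) ∈ M.accept
      ↔ ∃ h : i ++ k ∈ U.index, y ++ x ∈ U.member ⟨i ++ k, h⟩ := by
    rw [← hM, convolution_append_append h, evalFrom_eval_mem_accept_iff]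
  rw [hI]
  simp only [Set.forall_mem_image]
  constructor
  · rintro ⟨hi, H⟩
    refine ⟨hi, fun x hx hacc => ?_, fun x hx hacc => ?_⟩
    · obtain ⟨_, hacc⟩ := (h₁ x hx).1 hacc
      exact H x (.inl (hx.trans (List.prefix_append _ _))) hacc
    · obtain ⟨_, hacc⟩ := (h₂ x).1 hacc
      refine H (y ++ x) ?_ hacc
      simpa only [List.prefix_append_right_inj] using hx
  · rintro ⟨hi, H₁, H₂⟩
    refine ⟨hi, fun x hx hmem => ?_⟩
    have hxy : x <+: y ∨ y <+: x := by
      rcases hx with hx | hx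
      · exact List.prefix_or_prefix_of_prefix hx (List.prefix_append _ _)
      · exact .inr ((List.prefix_append _ _).trans hx)
    rcases hxy with hxy | ⟨t, rfl⟩
    · exact H₁ hxy ((h₁ x hxy).2 ⟨hi, hmem⟩)
    · exact H₂ t (by simpa only [List.prefix_append_right_inj] using hx) ((h₂ t).2 ⟨hi, hmem⟩)

/-- A subset construction handles the existential quantifier over `i`: the quotient by `y` is
determined by the set of profiles of `(y, i)` over all `i` of length `|y|`, and there are finitely
many such sets. -/
lemma isRegular_excluded : U.excluded.IsRegular := by
  obtain ⟨S, _, M, hM⟩ := U.automatic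
  obtain ⟨T, _, J, hJ⟩ := U.regular_index
  let profile (y i : List Bool) : S × Set S × T :=
    (M.eval (convolution y i), (fun x => M.eval (convolution x i)) '' {x | x <+: y}, J.eval i)
  let quot (P : Set (S × Set S × T)) : Language Bool :=
    {z | ∃ p ∈ P, ∃ k : List Bool, z.length = k.length ∧ J.evalFrom p.2.2 k ∈ J.accept ∧
      (∀ q ∈ p.2.1, M.evalFrom q (convolution [] k) ∉ M.accept) ∧
      ∀ x, (x <+: z ∨ z <+: x) → M.evalFrom p.1 (convolution x k) ∉ M.accept}
  refine .of_finite_range_leftQuotient <| (Set.finite_range quot).subset ?_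
  rintro _ ⟨y, rfl⟩
  refine ⟨profile y '' {i | y.length = i.length}, ?_⟩
  ext z
  rw [Language.mem_leftQuotient]
  constructor
  · rintro ⟨_, ⟨i, hi, rfl⟩, k, hk, H⟩
    exact ⟨i ++ k, by simp [hk, show y.length = i.length from hi],
      (U.excludes_append_iff hM hJ hi z k).2 H⟩
  · rintro ⟨j, hj, H⟩
    have hi : y.length = (j.take y.length).length := by
      simp only [List.length_append] at hj
      simp [← hj]
    refine ⟨_, ⟨j.take y.length, hi, rfl⟩, j.drop y.length, ?_, ?_⟩
    · simp only [List.length_append] at hj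
      simp [← hj]
    · rw [← List.take_append_drop y.length j] at H
      exact (U.excludes_append_iff hM hJ hi z _).1 H

/-- Two prefixes of the same sequence are comparable. -/
lemma coveringRegion_subset_compl_extensions_excluded :
    U.coveringRegion ⊆ (extensions U.excluded)ᶜ := by
  rintro X hX ⟨y, ⟨i, -, hi, H⟩, hy⟩
  obtain ⟨x, hx, hxX⟩ := Set.mem_iInter.1 hX ⟨i, hi⟩
  refine H x ?_ hx
  rw [← isPrefixOf_iff.1 hxX, ← isPrefixOf_iff.1 hy]
  exact (le_total x.length y.length).imp (initSeg_prefix_of_le X) (initSeg_prefix_of_le X)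

/-- After `(y, i)` the rest of a member is read against padding only, so acceptance depends just on
the state reached. Choosing one accepted continuation per state, where one exists, bounds the length
uniformly. -/
lemma exists_short_witness : ∃ c : ℕ, ∀ (i) (hi : i ∈ U.index) (y : List Bool),
    y.length = i.length → ¬ U.Excludes y i →
      ∃ z : List Bool, z.length ≤ c ∧ ∃ x ∈ U.member ⟨i, hi⟩, x <+: y ++ z := by
  obtain ⟨S, _, M, hM⟩ := U.automatic
  have hbound : ∃ c : ℕ, ∀ q : S, (∃ z, M.evalFrom q (convolution z []) ∈ M.accept) →
      ∃ z : List Bool, z.length ≤ c ∧ M.evalFrom q (convolution z []) ∈ M.accept := by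
    choose! f hf using fun (q : S) (h : ∃ z, M.evalFrom q (convolution z []) ∈ M.accept) => h
    obtain ⟨c, hc⟩ := (Set.finite_range fun q => (f q).length).bddAbove
    exact ⟨c, fun q hq => ⟨f q, hc ⟨q, rfl⟩, hf q hq⟩⟩
  obtain ⟨c, hc⟩ := hbound
  refine ⟨c, fun i hi y hy hex => ?_⟩
  have hacc (z) : M.evalFrom (M.eval (convolution y i)) (convolution z []) ∈ M.accept
      ↔ ∃ h : i ∈ U.index, y ++ z ∈ U.member ⟨i, h⟩ := by
    rw [evalFrom_eval_mem_accept_iff, ← convolution_append_append hy, List.append_nil]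
    exact hM _ _
  unfold Excludes at hex
  push Not at hex
  obtain ⟨x, hx | ⟨z, rfl⟩, hxU⟩ := hex hi
  · exact ⟨[], by simp, x, hxU, by simpa using hx⟩
  · obtain ⟨z, hz, hzU⟩ := hc _ ⟨z, (hacc z).2 ⟨hi, hxU⟩⟩
    obtain ⟨_, hzU⟩ := (hacc z).1 hzU
    exact ⟨z, hz, _, hzU, List.prefix_rfl⟩

lemma IsART.measure_compl_extensions_excluded {U : AutomaticFamily} (hU : U.IsART) :
    cantorMeasure (extensions U.excluded)ᶜ = 0 := by
  obtain ⟨c, hc⟩ := U.exists_short_witness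
  set δ : ENNReal := 2⁻¹ ^ c
  have key (i : {i // i ∈ U.index}) :
      δ * cantorMeasure (extensions U.excluded)ᶜ ≤ cantorMeasure (extensions (U.member i)) := by
    -- Prefixes of length `|i|` of these sequences are not excluded by `i`, so `[U_i]` has relative
    -- measure at least `δ` in their cylinders.
    have hsub : (extensions U.excluded)ᶜ ⊆
        {X | initSeg X i.1.length ∈ {y | ¬ U.Excludes y i.1}} := fun X hX hex =>
      hX (mem_extensions_iff.2 ⟨i.1.length, i.1, by simp, hex⟩)
    refine le_trans (mul_le_mul_right (measure_mono hsub) _) <|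
      (mul_measure_initSeg_mem_le _ _ (measurableSet_extensions (U.member i)) ?_).trans
        (measure_mono Set.inter_subset_left)
    intro y hy hlen
    obtain ⟨z, hz, x, hx, hxy⟩ := hc i.1 i.2 y hlen hy
    calc δ * cantorMeasure (cyl y) ≤ cantorMeasure (cyl (y ++ z)) := by
          rw [cantorMeasure_cyl, cantorMeasure_cyl, List.length_append, pow_add, mul_comm]
          exact mul_le_mul_right (pow_le_pow_right_of_le_one' (by simp) hz) _
      _ ≤ _ := measure_mono (Set.subset_inter
          (show cyl (y ++ z) ⊆ extensions (U.member i) from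
            fun X hX => ⟨x, hx, IsPrefixOf.of_prefix hxy hX⟩)
          (cyl_subset_of_prefix (List.prefix_append y z)))
  have h : δ * cantorMeasure (extensions U.excluded)ᶜ ≤ 0 := by
    rw [← hU]
    exact Filter.le_liminf_of_le (by isBoundedDefault) (.of_forall key)
  exact (mul_eq_zero.1 (le_antisymm h zero_le)).resolve_left (pow_ne_zero _ (by simp))

end AutomaticFamily

end AutomaticRandomness

theorem theorem8 (X : ℕ → Bool) :
    List.TFAE [
      ∃ U : AutomaticRandomness.AutomaticFamily, U.IsART ∧ X ∈ U.coveringRegion,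
      ∃ (S : Type) (_ : Finite S) (M : AutomaticRandomness.BuchiAutomaton S),
        AutomaticRandomness.cantorMeasure M.language = 0 ∧ X ∈ M.language,
      ∃ (S : Type) (_ : Finite S) (M : AutomaticRandomness.MullerAutomaton S),
        AutomaticRandomness.cantorMeasure M.language = 0 ∧ X ∈ M.language,
      ¬ AutomaticRandomness.Disjunctive X] := by
  open AutomaticRandomness in
  tfae_have 1 → 2 := by
    rintro ⟨U, hU, hX⟩
    obtain ⟨S, hS, M, hM⟩ := (extensionClosed_extensionClosure U.excluded).exists_buchi
      (isRegular_extensionClosure U.isRegular_excluded)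
    rw [extensions_extensionClosure] at hM
    exact ⟨S, hS, M, by rw [hM, hU.measure_compl_extensions_excluded],
      hM ▸ U.coveringRegion_subset_compl_extensions_excluded hX⟩
  tfae_have 2 → 3 := by
    rintro ⟨S, hS, M, h0, hX⟩
    exact ⟨S, hS, M.toMuller, M.language_toMuller ▸ h0, M.language_toMuller ▸ hX⟩
  tfae_have 3 → 4 := by
    rintro ⟨S, hS, M, h0, hX⟩ hdisj
    exact (M.measure_language_pos hdisj hX).ne' h0
  tfae_have 4 → 1 := by
    intro h
    rw [AutomaticRandomness.disjunctive_iff] at h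
    push Not at h
    obtain ⟨w, hw⟩ := h
    exact ⟨_, (AutomaticRandomness.extensionClosed_containing w).isART_avoidingFamily
        (AutomaticRandomness.isRegular_containing w)
        (AutomaticRandomness.measure_compl_extensions_containing w),
      AutomaticRandomness.coveringRegion_avoidingFamily _ hw⟩
  tfae_finish
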